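/- Let $G$ be a finite connected simple graph with vertex set $A=\{x_0,x_1,\ldots,x_n\}$ ($n\ge 0$, the $x_j$ distinct), and let $d(x)$ denote the degree of $x$. Simple random walk on $G$ is the Markov chain with transition probabilities $Q(x,y)=1/d(x)$ if $x,y$ are adjacent and $Q(x,y)=0$ otherwise. The chronological loop-erasure of a finite path $[\omega_0,\ldots,\omega_m]$ is $[\omega_{j_0},\omega_{j_1},\ldots,\omega_{j_k}]$, where $j_0=\max\{j:\omega_j=\omega_0\}$, recursively $j_{i+1}=\max\{j:\omega_j=\omega_{j_i+1}\}$ as long as $j_i<m$, and $j_k=m$. Wilson's algorithm for the ordering $x_0,\ldots,x_n$ starts with the tree consisting of the single vertex $x_0$ and no edges. As long as some vertex is not in the tree, let $x_j$ be the one of smallest index, run a simple random walk started at $x_j$, independent of all the others, until it first hits a vertex of the tree, erase its loops chronologically, and add the vertices and edges of the resulting path to the tree. **Theorem.** With probability one, every walk used hits the current tree and the final output is a spanning tree of $G$; and every spanning tree of $G$ is output with the same probability, namely $1/N$, where $N$ is the number of spanning trees of $G$. Moreover, $$N=\det[D-K],$$ where $D$ is the diagonal matrix of degrees, $D(x,y)=\delta_{x,y}\,d(x)$,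 and $K$ is the adjacency matrix of $G$, both restricted to $\{x_1,\ldots,x_n\}$ (the determinant of the empty matrix is $1$). In particular, $\det[D-K]$ does not depend on the ordering $\{x_0,\ldots,x_n\}$ of the vertices of $G$. -/

import Mathlib

open MeasureTheory ProbabilityTheory

namespace Wilson

section RandomWalk

variable {V : Type*} [Fintype V]

/-- One step of simple random walk on `G`: from `v`, jump to a uniformly chosen neighbour of `v`.
(At a vertex without neighbours, where the step is not defined, the walk stays put; in a connected
graph with at least two vertices this does not occur.) -/
noncomputable def srwStep (G : SimpleGraph V) [DecidableRel G.Adj] (v : V) : PMF V :=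
  if h : (G.neighborFinset v).Nonempty then PMF.uniformOfFinset (G.neighborFinset v) h
  else PMF.pure v

/-- The transition kernel of simple random walk: the law of the position at time `k + 1` given
the positions up to time `k` is that of one step from the position at time `k`. -/
noncomputable def srwKernel [MeasurableSpace V] [MeasurableSingletonClass V]
    (G : SimpleGraph V) [DecidableRel G.Adj] (k : ℕ) :
    Kernel ((i : Finset.Iic k) → (fun _ : ℕ => V) i) V :=
  Kernel.ofFunOfCountable fun h => (srwStep G (h ⟨k, Finset.mem_Iic.2 le_rfl⟩)).toMeasure

instance [MeasurableSpace V] [MeasurableSingletonClass V]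
    (G : SimpleGraph V) [DecidableRel G.Adj] (k : ℕ) : IsMarkovKernel (srwKernel G k) where
  isProbabilityMeasure _ := PMF.toMeasure.isProbabilityMeasure _

/-- The law, on trajectories `ℕ → V`, of simple random walk on `G` started at `v`. -/
noncomputable def srwLaw [MeasurableSpace V] [MeasurableSingletonClass V]
    (G : SimpleGraph V) [DecidableRel G.Adj] (v : V) : Measure (ℕ → V) :=
  Kernel.trajMeasure (X := fun _ : ℕ => V) (Measure.dirac v) (srwKernel G)

end RandomWalk

section Algorithm

variable {V : Type*} [DecidableEq V]

/-- Chronological loop-erasure of a finite path: keep the first point `a`, discard everything up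
to and including the last visit to `a`, and continue with the remaining path. -/
def loopErase : List V → List V
  | [] => []
  | a :: l => a :: loopErase (l.rtakeWhile fun b => b ≠ a)
termination_by l => l.length
decreasing_by
  exact Nat.lt_succ_of_le (List.rtakeWhile_suffix _ _).length_le

/-- The graph on `V` whose edges are those traversed by the path `p`. -/
def traversedEdges (p : List V) : SimpleGraph V :=
  SimpleGraph.fromEdgeSet {e | ∃ q ∈ p.zip p.tail, e = s(q.1, q.2)}

/-- The tree built so far: the set of vertices and the edges already added. -/
structure PartialTree (V : Type*) where
  verts : Finset V
  graph : SimpleGraph V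

open Classical in
/-- The path followed by the trajectory `w` up to and including its first visit to `S`;
`none` if `w` never visits `S`. -/
noncomputable def runUntil (S : Finset V) (w : ℕ → V) : Option (List V) :=
  if h : ∃ k, w k ∈ S then some ((List.range (Nat.find h + 1)).map w) else none

/-- One round of Wilson's algorithm at the vertex `v`, where `w` is a walk started at `v`. If `v`
is in the tree already, nothing happens. Otherwise the walk is run until it hits the tree, its
loops are erased, and what remains is added to the tree. The result is `none` if the walk never
hits the tree. -/
noncomputable def wilsonRound (t : PartialTree V) (v : V) (w : ℕ → V) :
    Option (PartialTree V) :=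
  if v ∈ t.verts then some t
  else (runUntil t.verts w).map fun p =>
    { verts := t.verts ∪ (loopErase p).toFinset
      graph := t.graph ⊔ traversedEdges (loopErase p) }

/-- Wilson's algorithm for the ordering `x 0, x 1, …, x n` of the vertices, where `w j` is the
walk started at `x (j + 1)`. It starts with the tree `{x 0}` and goes through `x 1, …, x n` in
this order, skipping the vertices that have been added already; so each round that is not skipped
starts at the vertex of smallest index not yet in the tree. The output is the graph of all edges
added (on the vertex set `V`), or `none` if one of the walks never hits the tree. -/
noncomputable def wilson {n : ℕ} (x : Fin (n + 1) → V) (w : Fin n → ℕ → V) :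
    Option (SimpleGraph V) :=
  ((List.finRange n).foldlM (fun t j => wilsonRound t (x j.succ) (w j))
    { verts := {x 0}, graph := ⊥ }).map PartialTree.graph

end Algorithm

/-- The spanning trees of `G`: the subgraphs of `G` on all of its vertices that are trees. -/
def spanningTrees {V : Type*} (G : SimpleGraph V) : Set (SimpleGraph V) :=
  {T | T ≤ G ∧ T.IsTree}

/-- The matrix `D - K` of the graph `G` for the ordering `x 0, …, x n` of its vertices:
the graph Laplacian (diagonal matrix of degrees minus adjacency matrix), restricted to
`x 1, …, x n`. -/
def reducedLaplacian {V : Type*} [Fintype V] [DecidableEq V] (G : SimpleGraph V)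
    [DecidableRel G.Adj] {n : ℕ} (x : Fin (n + 1) → V) : Matrix (Fin n) (Fin n) ℤ :=
  (G.degMatrix ℤ - G.adjMatrix ℤ).submatrix (fun i => x i.succ) (fun i => x i.succ)

end Wilson

/-!
Wilson's algorithm outputs every spanning tree with the same probability because the probability of
each branch it adds is a ratio of determinants, and these ratios telescope.

For a set `S` of vertices let `Δ_S` be the graph Laplacian with the rows and columns of `S` removed
(`dirichletLaplacian`). If the tree built so far has vertex set `S`, then the loop-erasure of the
walk started at `a ∉ S` and run until it hits `S` equals a given self-avoiding path `η` from `a` to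
`S`, which meets `S` only at its end, with probability `det Δ_{S ∪ η} / det Δ_S`
(`srwLaw_loopErase_mul_det`). This is proved by induction on the length of `η = a :: η'`. Let `f u`
be the probability that the walk from `u` visits `a` before `S` and that its path from the last
visit to `a` up to `S` has loop-erasure `η`. By the Markov property at time one
(`degree_mul_srwLaw_real`) `f` vanishes on `S`, is harmonic off `S ∪ {a}`, and satisfies `(Δ_S f) a
= c`, where `c` is the probability that the walk from the first vertex of `η'`, stopped in `S ∪
{a}`, has loop-erasure `η'`. By Cramer's rule `f a = c * det Δ_{S ∪ {a}} / det Δ_S`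
(`mul_det_of_laplacian_eq_single`), and `c` is known by induction.

The same Dirichlet problem has only the zero solution when `S` is nonempty and `G` is connected, by
the energy identity for the Laplacian (`eq_zero_of_harmonic`). Hence `det Δ_S ≠ 0`, and the walk
hits `S` almost surely (`ae_exists_mem`), so that the algorithm almost surely ends; each round
attaches the vertices of a self-avoiding path one by one as leaves, so the output is a spanning
tree (`exists_foldlM_eq_some`).

Given a spanning tree `T`, the branch to be added in each round is the unique path of `T` from the
starting point to the tree built so far. Thus, almost surely, the output is `T` if and only if each
of the independent walks lies in a certain set depending on `T`, and the product of the
probabilities of these sets telescopes to `1 / det Δ_{x 0}` (`exists_sets_foldlM_eq_some_iff`).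
Summing over all spanning trees gives `N = det Δ_{x 0}`, and this number does not involve the
ordering.
-/

namespace Wilson

/-! ### The Markov property of simple random walk -/

section Trajectories

variable {V : Type*}

/-- The trajectories which agree with `p` up to time `k`. -/
def pathCylinder (k : ℕ) (p : ℕ → V) : Set (ℕ → V) := {w | ∀ i ≤ k, w i = p i}

theorem frestrictLe_preimage_singleton (k : ℕ) (p : ℕ → V) :
    (Preorder.frestrictLe (π := fun _ : ℕ => V) k) ⁻¹' {Preorder.frestrictLe k p}
      = pathCylinder k p := by
  ext w
  simp only [Set.mem_preimage, Set.mem_singleton_iff, pathCylinder, Set.mem_ofPred_eq, funext_iff,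
    Preorder.frestrictLe_apply]
  exact ⟨fun h i hi => h ⟨i, Finset.mem_Iic.2 hi⟩, fun h i => h i (Finset.mem_Iic.1 i.2)⟩

/-- The trajectory which starts at `v` and continues as `w`. -/
def consWalk (v : V) (w : ℕ → V) : ℕ → V
  | 0 => v
  | k + 1 => w k

theorem consWalk_preimage_pathCylinder_succ (v : V) (k : ℕ) (p : ℕ → V) :
    consWalk v ⁻¹' pathCylinder (k + 1) p
      = {w | v = p 0 ∧ w ∈ pathCylinder k fun i => p (i + 1)} := by
  ext w
  simp only [pathCylinder, Set.mem_preimage, Set.mem_ofPred_eq]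
  refine ⟨fun h => ⟨h 0 (by omega), fun i hi => h (i + 1) (by omega)⟩, fun h i hi => ?_⟩
  cases i with
  | zero => exact h.1
  | succ i => exact h.2 i (by omega)

variable [MeasurableSpace V]

theorem measurable_consWalk (v : V) : Measurable (consWalk v) := by
  refine measurable_pi_iff.2 fun k => ?_
  cases k with
  | zero => exact measurable_const
  | succ k => exact measurable_pi_apply k

theorem measurableSet_pathCylinder [MeasurableSingletonClass V] (k : ℕ) (p : ℕ → V) :
    MeasurableSet (pathCylinder k p) := by
  have : pathCylinder k p = ⋂ i, ⋂ (_ : i ≤ k), (fun w : ℕ → V => w i) ⁻¹' {p i} := by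
    ext w; simp [pathCylinder]
  rw [this]
  exact MeasurableSet.iInter fun i => MeasurableSet.iInter fun _ =>
    measurable_pi_apply i (measurableSet_singleton _)

end Trajectories

section Markov

variable {V : Type*} [Fintype V] (G : SimpleGraph V) [DecidableRel G.Adj]

theorem srwStep_apply (v y : V) (hv : 0 < G.degree v) :
    srwStep G v y = if G.Adj v y then ((G.degree v : ENNReal))⁻¹ else 0 := by
  have hne : (G.neighborFinset v).Nonempty := Finset.card_pos.1 hv
  rw [srwStep, dif_pos hne, PMF.uniformOfFinset_apply]
  simp only [SimpleGraph.mem_neighborFinset, SimpleGraph.card_neighborFinset_eq_degree]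

variable [MeasurableSpace V] [MeasurableSingletonClass V]

instance isProbabilityMeasure_srwLaw (v : V) : IsProbabilityMeasure (srwLaw G v) := by
  unfold srwLaw; infer_instance

theorem srwLaw_pathCylinder_zero [DecidableEq V] (v : V) (p : ℕ → V) :
    srwLaw G v (pathCylinder 0 p) = if p 0 = v then 1 else 0 := by
  rw [← frestrictLe_preimage_singleton,
    ← Measure.map_apply (Preorder.measurable_frestrictLe 0) (measurableSet_singleton _)]
  unfold srwLaw Kernel.trajMeasure
  rw [Measure.map_comp _ _ (Preorder.measurable_frestrictLe 0), Kernel.traj_map_frestrictLe,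
    Kernel.partialTraj_self]
  erw [Measure.id_comp]
  rw [Measure.map_apply (MeasurableEquiv.measurable _) (measurableSet_singleton _),
    Measure.dirac_apply' _ (MeasurableEquiv.measurable _ (measurableSet_singleton _))]
  have hmem : v ∈ (MeasurableEquiv.piUnique fun _ : Finset.Iic 0 => V).symm ⁻¹'
      {Preorder.frestrictLe 0 p} ↔ p 0 = v := by
    rw [Set.mem_preimage, Set.mem_singleton_iff, MeasurableEquiv.symm_apply_eq, eq_comm (a := v)]
    rfl
  by_cases h : p 0 = v
  · rw [if_pos h, Set.indicator_of_mem (hmem.2 h), Pi.one_apply]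
  · rw [if_neg h, Set.indicator_of_notMem (mt hmem.1 h)]

theorem srwLaw_pathCylinder_succ (v : V) (k : ℕ) (p : ℕ → V) :
    srwLaw G v (pathCylinder (k + 1) p)
      = srwLaw G v (pathCylinder k p) * srwStep G (p k) (p (k + 1)) := by
  have h := Kernel.map_frestrictLe_trajMeasure_compProd_eq_map_trajMeasure
    (X := fun _ : ℕ => V) (κ := srwKernel G) (μ₀ := Measure.dirac v) (a := k)
  have h2 := congrArg (fun μ => μ ({Preorder.frestrictLe k p} ×ˢ {p (k + 1)})) h
  beta_reduce at h2
  rw [Measure.compProd_apply_prod (measurableSet_singleton _) (measurableSet_singleton _),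
    lintegral_singleton,
    Measure.map_apply (Preorder.measurable_frestrictLe k) (measurableSet_singleton _),
    frestrictLe_preimage_singleton, Measure.map_apply (by fun_prop)
      ((measurableSet_singleton _).prod (measurableSet_singleton _))] at h2
  have e1 : (srwKernel G k) (Preorder.frestrictLe k p) {p (k + 1)}
      = srwStep G (p k) (p (k + 1)) :=
    PMF.toMeasure_apply_singleton _ _ (measurableSet_singleton _)
  have e2 : (fun x : ℕ → V => (Preorder.frestrictLe (π := fun _ : ℕ => V) k x, x (k + 1))) ⁻¹'
      ({Preorder.frestrictLe k p} ×ˢ {p (k + 1)}) = pathCylinder (k + 1) p := by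
    ext w
    have : Preorder.frestrictLe (π := fun _ : ℕ => V) k w = Preorder.frestrictLe k p
        ↔ w ∈ pathCylinder k p := by
      rw [← frestrictLe_preimage_singleton]; rfl
    simp only [Set.mem_preimage, Set.mem_prod, Set.mem_singleton_iff, this, pathCylinder,
      Set.mem_ofPred_eq]
    refine ⟨fun h i hi => ?_, fun h => ⟨fun i hi => h i (by omega), h _ le_rfl⟩⟩
    rcases Nat.lt_or_ge k i with hik | hik
    · obtain rfl : i = k + 1 := by omega
      exact h.2
    · exact h.1 i hik
  rw [e1, e2] at h2
  rw [mul_comm]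
  exact h2.symm

/-- Finite measures on trajectories are determined by the finite-dimensional cylinders. -/
theorem measure_ext_of_pathCylinder {μ ν : Measure (ℕ → V)} [IsFiniteMeasure μ]
    (h : ∀ k p, μ (pathCylinder k p) = ν (pathCylinder k p)) : μ = ν := by
  have hμ : IsProjectiveLimit (α := fun _ : ℕ => V) μ (fun I => μ.map I.restrict) := fun I => rfl
  refine hμ.unique ((isProjectiveLimit_nat_iff (fun I J hJI => ?_) ν).2 fun k => ?_)
  · rw [Measure.map_map (by fun_prop) (by fun_prop)]
    rfl
  · refine Measure.ext_of_singleton fun q => ?_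
    obtain ⟨p, rfl⟩ : ∃ p : ℕ → V, q = Preorder.frestrictLe k p := by
      refine ⟨fun i => q ⟨min i k, Finset.mem_Iic.2 (min_le_right _ _)⟩, ?_⟩
      funext i
      have := Finset.mem_Iic.1 i.2
      simp [Preorder.frestrictLe_apply, this]
    rw [Measure.map_apply (Preorder.measurable_frestrictLe k) (measurableSet_singleton _)]
    change _ = μ.map (Preorder.frestrictLe (π := fun _ : ℕ => V) k) _
    rw [Measure.map_apply (Preorder.measurable_frestrictLe k) (measurableSet_singleton _),
      frestrictLe_preimage_singleton, h]

/-- The Markov property at time `1`. -/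
theorem srwLaw_eq_sum_step (v : V) :
    srwLaw G v = ∑ y, srwStep G v y • (srwLaw G y).map (consWalk v) := by
  classical
  refine measure_ext_of_pathCylinder fun k p => ?_
  have key : ∀ k p, (∑ y, srwStep G v y • (srwLaw G y).map (consWalk v)) (pathCylinder k p)
      = ∑ y, srwStep G v y * srwLaw G y (consWalk v ⁻¹' pathCylinder k p) := by
    intro k p
    rw [Measure.finsetSum_apply]
    refine Finset.sum_congr rfl fun y _ => ?_
    rw [Measure.smul_apply, Measure.map_apply (measurable_consWalk v)
      (measurableSet_pathCylinder k p), smul_eq_mul]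
  induction k generalizing p with
  | zero =>
    rw [key, srwLaw_pathCylinder_zero]
    have : consWalk v ⁻¹' pathCylinder 0 p = {w | p 0 = v} := by
      ext w
      simp [pathCylinder, consWalk, eq_comm]
    rw [this]
    by_cases h : p 0 = v
    · have hs := (srwStep G v).tsum_coe
      rw [tsum_fintype] at hs
      simp [h, hs]
    · simp [h]
  | succ k ih =>
    rw [key, srwLaw_pathCylinder_succ]
    simp only [consWalk_preimage_pathCylinder_succ]
    by_cases h : v = p 0
    · simp only [h, true_and, Set.ofPred_mem_eq]
      cases k with
      | zero =>
        simp only [srwLaw_pathCylinder_zero]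
        simp [eq_comm]
      | succ k =>
        rw [← h, ih, key]
        simp only [consWalk_preimage_pathCylinder_succ, srwLaw_pathCylinder_succ, h, true_and,
          Set.ofPred_mem_eq, Finset.sum_mul, mul_assoc]
    · have h0 : srwLaw G v (pathCylinder k p) = 0 := by
        refine measure_mono_null (t := pathCylinder 0 p)
          (fun w hw i hi => hw i (by omega)) ?_
        rw [srwLaw_pathCylinder_zero, if_neg (Ne.symm h)]
      simp [h, h0]

/-- The Markov property at time `1`, for the probability of an event. -/
theorem srwLaw_apply (v : V) {A : Set (ℕ → V)} (hA : MeasurableSet A) :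
    srwLaw G v A = ∑ y, srwStep G v y * srwLaw G y (consWalk v ⁻¹' A) := by
  conv_lhs => rw [srwLaw_eq_sum_step]
  rw [Measure.finsetSum_apply]
  refine Finset.sum_congr rfl fun y _ => ?_
  rw [Measure.smul_apply, Measure.map_apply (measurable_consWalk v) hA, smul_eq_mul]

theorem ae_srwLaw_start (v : V) : ∀ᵐ w ∂srwLaw G v, w 0 = v := by
  classical
  have h : srwLaw G v {w | w 0 = v} = 1 := by
    have h0 := srwLaw_pathCylinder_zero G v fun _ => v
    simpa [pathCylinder] using h0
  rw [ae_iff]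
  have hm : MeasurableSet {w : ℕ → V | w 0 = v} :=
    measurableSet_preimage (f := fun w : ℕ → V => w 0) (measurable_pi_apply 0)
      (measurableSet_singleton v)
  exact (prob_compl_eq_zero_iff hm).2 h

/-- The Markov property at time `1`, for real-valued probabilities, cleared of denominators. -/
theorem degree_mul_srwLaw_real (v : V) (hv : 0 < G.degree v) {A : Set (ℕ → V)}
    (hA : MeasurableSet A) :
    (G.degree v : ℝ) * (srwLaw G v).real A
      = ∑ y ∈ G.neighborFinset v, (srwLaw G y).real (consWalk v ⁻¹' A) := by
  classical
  have hd : (G.degree v : ENNReal) ≠ 0 := by exact_mod_cast hv.ne'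
  have h : (G.degree v : ENNReal) * srwLaw G v A
      = ∑ y ∈ G.neighborFinset v, srwLaw G y (consWalk v ⁻¹' A) := by
    rw [srwLaw_apply G v hA, Finset.mul_sum]
    have : ∀ y, (G.degree v : ENNReal) * (srwStep G v y * srwLaw G y (consWalk v ⁻¹' A))
        = if y ∈ G.neighborFinset v then srwLaw G y (consWalk v ⁻¹' A) else 0 := by
      intro y
      simp only [srwStep_apply G v y hv, SimpleGraph.mem_neighborFinset]
      split_ifs
      · rw [← mul_assoc, ENNReal.mul_inv_cancel hd (ENNReal.natCast_ne_top _), one_mul]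
      · simp
    simp only [this, Finset.sum_ite_mem, Finset.univ_inter]
  have := congrArg ENNReal.toReal h
  rw [ENNReal.toReal_mul, ENNReal.toReal_sum (fun _ _ => measure_ne_top _ _)] at this
  simpa [Measure.real] using this

variable {G} in
theorem srwLaw_real_eq_zero {v : V} {A : Set (ℕ → V)} (h : ∀ w ∈ A, w 0 ≠ v) :
    (srwLaw G v).real A = 0 :=
  (measureReal_eq_zero_iff (measure_ne_top _ _)).2
    (measure_mono_null h (ae_iff.1 (ae_srwLaw_start G v)))

/-- Simple random walk almost surely only moves along edges. -/
theorem ae_srwLaw_adj (hdeg : ∀ v, 0 < G.degree v) (v : V) :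
    ∀ᵐ w ∂srwLaw G v, ∀ k, G.Adj (w k) (w (k + 1)) := by
  rw [ae_all_iff]
  intro k
  have hm : ∀ k, MeasurableSet {w : ℕ → V | G.Adj (w k) (w (k + 1))} := fun k =>
    measurableSet_preimage (f := fun w : ℕ → V => (w k, w (k + 1)))
      ((measurable_pi_apply k).prodMk (measurable_pi_apply (k + 1)))
      (Set.toFinite {q : V × V | G.Adj q.1 q.2}).measurableSet
  induction k generalizing v with
  | zero =>
    rw [ae_iff, show {w : ℕ → V | ¬ G.Adj (w 0) (w (0 + 1))} = {w | G.Adj (w 0) (w (0 + 1))}ᶜ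
      from rfl, srwLaw_apply G v (hm 0).compl]
    refine Finset.sum_eq_zero fun y _ => ?_
    rw [srwStep_apply G v y (hdeg v)]
    split_ifs with hy
    · have : srwLaw G y (consWalk v ⁻¹' {w | G.Adj (w 0) (w (0 + 1))}ᶜ) = 0 := by
        refine measure_mono_null (fun w hw => ?_) (ae_iff.1 (ae_srwLaw_start G y))
        intro h0
        exact hw (by simpa [consWalk, h0] using hy)
      rw [this, mul_zero]
    · exact zero_mul _
  | succ k ih =>
    rw [ae_iff, show {w : ℕ → V | ¬ G.Adj (w (k + 1)) (w (k + 1 + 1))}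
      = {w | G.Adj (w (k + 1)) (w (k + 1 + 1))}ᶜ from rfl, srwLaw_apply G v (hm _).compl]
    refine Finset.sum_eq_zero fun y _ => ?_
    have : srwLaw G y (consWalk v ⁻¹' {w | G.Adj (w (k + 1)) (w (k + 1 + 1))}ᶜ) = 0 :=
      ae_iff.1 (ih y)
    rw [this, mul_zero]

end Markov

/-! ### The Dirichlet problem for the graph Laplacian -/

section DirichletLaplacian

open Matrix

/-- A diagonal cofactor of a square matrix is the determinant of the matrix with the corresponding
row and column removed. -/
theorem adjugate_apply_self {m R : Type*} [Fintype m] [DecidableEq m] [CommRing R]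
    (M : Matrix m m R) (a : m) :
    M.adjugate a a
      = (M.submatrix (Subtype.val : {i // i ≠ a} → m) (Subtype.val : {i // i ≠ a} → m)).det := by
  -- expanding the row `a` of the defining determinant leaves the block of indices other than `a`
  rw [adjugate_apply, twoBlockTriangular_det (M.updateRow a (Pi.single a 1)) (fun i => i ≠ a)]
  · have h1 : (toSquareBlockProp (M.updateRow a (Pi.single a 1)) fun i => i ≠ a)
        = M.submatrix (Subtype.val : {i // i ≠ a} → m) (Subtype.val : {i // i ≠ a} → m) := by
      ext i j
      simp [toSquareBlockProp, updateRow_ne i.2]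
    have h2 : (toSquareBlockProp (M.updateRow a (Pi.single a 1)) fun i => ¬ i ≠ a) = 1 := by
      ext i j
      have hi : i.1 = a := not_not.1 i.2
      have hj : j.1 = a := not_not.1 j.2
      have hij : i = j := Subtype.ext (hi.trans hj.symm)
      subst hij
      simp [toSquareBlockProp, hi]
    rw [h1, h2, det_one, mul_one]
  · intro i hi j hj
    rw [not_not.1 hi]
    simp [hj]

variable {V : Type*} [Fintype V] [DecidableEq V] (G : SimpleGraph V) [DecidableRel G.Adj]

/-- The graph Laplacian with Dirichlet boundary condition on `S`: the rows and columns indexed by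
the vertices of `S` are removed. -/
def dirichletLaplacian (S : Finset V) : Matrix {v // v ∉ S} {v // v ∉ S} ℝ :=
  (G.lapMatrix ℝ).submatrix Subtype.val Subtype.val

theorem dirichletLaplacian_mulVec {S : Finset V} {f : V → ℝ} (hf : ∀ v ∈ S, f v = 0)
    (u : {v // v ∉ S}) :
    (dirichletLaplacian G S *ᵥ fun v => f v) u
      = G.degree u.1 * f u - ∑ y ∈ G.neighborFinset u.1, f y := by
  rw [← SimpleGraph.lapMatrix_mulVec_apply]
  simp only [mulVec, dotProduct, dirichletLaplacian, submatrix_apply]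
  rw [← Finset.sum_subtype (Finset.univ.filter (· ∉ S)) (by simp)
    (fun v => G.lapMatrix ℝ u.1 v * f v)]
  refine Finset.sum_subset (Finset.subset_univ _) fun v _ hv => ?_
  rw [hf v (by simpa using hv), mul_zero]

variable {G}

/-- The Dirichlet problem has a unique solution: a function which vanishes on a nonempty set `S`
and is harmonic off `S` vanishes, since its Dirichlet energy does. -/
theorem eq_zero_of_harmonic (hG : G.Connected) {S : Finset V} (hS : S.Nonempty) {f : V → ℝ}
    (hf : ∀ v ∈ S, f v = 0)
    (hharm : ∀ v ∉ S, G.degree v * f v = ∑ y ∈ G.neighborFinset v, f y) (v : V) : f v = 0 := by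
  have h : toLinearMap₂' ℝ (G.lapMatrix ℝ) f f = 0 := by
    rw [toLinearMap₂'_apply']
    refine Finset.sum_eq_zero fun u _ => ?_
    by_cases hu : u ∈ S
    · rw [hf u hu, zero_mul]
    · rw [SimpleGraph.lapMatrix_mulVec_apply, hharm u hu, sub_self, mul_zero]
  rw [SimpleGraph.lapMatrix_toLinearMap₂'_apply'_eq_zero_iff_forall_reachable] at h
  obtain ⟨s, hs⟩ := hS
  rw [h v s (hG.preconnected v s), hf s hs]

theorem det_dirichletLaplacian_ne_zero (hG : G.Connected) {S : Finset V} (hS : S.Nonempty) :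
    (dirichletLaplacian G S).det ≠ 0 := by
  intro h0
  obtain ⟨g, hg, h⟩ := exists_mulVec_eq_zero_iff.2 h0
  let f : V → ℝ := fun v => if hv : v ∉ S then g ⟨v, hv⟩ else 0
  have hfS : ∀ v ∈ S, f v = 0 := fun v hv => dif_neg (not_not.2 hv)
  have hfg : (fun v : {v // v ∉ S} => f v) = g := by
    funext v
    exact dif_pos v.2
  have hf := eq_zero_of_harmonic hG hS hfS fun v hv => by
    have h2 := dirichletLaplacian_mulVec G hfS ⟨v, hv⟩
    rw [hfg, h] at h2
    exact (sub_eq_zero.1 h2.symm)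
  exact hg (by rw [← hfg]; funext v; exact hf v)

theorem adjugate_dirichletLaplacian_apply_self {S : Finset V} {a : V} (ha : a ∉ S) :
    (dirichletLaplacian G S).adjugate ⟨a, ha⟩ ⟨a, ha⟩
      = (dirichletLaplacian G (insert a S)).det := by
  rw [adjugate_apply_self]
  let e : {v // v ∉ insert a S} ≃ {i : {v // v ∉ S} // i ≠ ⟨a, ha⟩} :=
    { toFun := fun v => ⟨⟨v.1, fun h => v.2 (Finset.mem_insert_of_mem h)⟩, fun h =>
        v.2 (Finset.mem_insert.2 (Or.inl (congrArg Subtype.val h)))⟩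
      invFun := fun v => ⟨v.1.1, fun h => (Finset.mem_insert.1 h).elim
        (fun h => v.2 (Subtype.ext h)) v.1.2⟩
      left_inv := fun _ => rfl
      right_inv := fun _ => rfl }
  rw [← det_submatrix_equiv_self e]
  rfl

/-- If `f` vanishes on `S` and its Laplacian off `S` is the point mass `c` at `a`, then
Cramer's rule gives the value of `f` at `a`. -/
theorem mul_det_of_laplacian_eq_single {S : Finset V} {a : V} (ha : a ∉ S)
    {f : V → ℝ} {c : ℝ} (hf : ∀ v ∈ S, f v = 0)
    (hharm : ∀ v ∉ S, v ≠ a → G.degree v * f v = ∑ y ∈ G.neighborFinset v, f y)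
    (hfa : G.degree a * f a = (∑ y ∈ G.neighborFinset a, f y) + c) :
    f a * (dirichletLaplacian G S).det = c * (dirichletLaplacian G (insert a S)).det := by
  have h : (dirichletLaplacian G S *ᵥ fun v => f v) = Pi.single ⟨a, ha⟩ c := by
    funext u
    rw [dirichletLaplacian_mulVec G hf]
    by_cases hu : u = ⟨a, ha⟩
    · subst hu
      simp [hfa]
    · rw [Pi.single_eq_of_ne hu, hharm u.1 u.2 fun h => hu (Subtype.ext h), sub_self]
  have h2 := congrArg (fun g => ((dirichletLaplacian G S).adjugate *ᵥ g) ⟨a, ha⟩) h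
  simp only [mulVec_mulVec, adjugate_mul, smul_mulVec, one_mulVec, Pi.smul_apply, smul_eq_mul,
    mulVec_single, MulOpposite.smul_eq_mul_unop, MulOpposite.unop_op, col_apply,
    adjugate_dirichletLaplacian_apply_self] at h2
  linarith

theorem det_dirichletLaplacian_univ :
    (dirichletLaplacian G Finset.univ).det = 1 := by
  have : IsEmpty {v : V // v ∉ (Finset.univ : Finset V)} := ⟨fun v => v.2 (Finset.mem_univ _)⟩
  exact det_isEmpty

theorem det_reducedLaplacian {n : ℕ} (x : Fin (n + 1) ≃ V) :
    ((reducedLaplacian G x).det : ℝ) = (dirichletLaplacian G {x 0}).det := by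
  let e : Fin n ≃ {v // v ∉ ({x 0} : Finset V)} := Equiv.ofBijective
    (fun i => ⟨x i.succ, by simp [Fin.succ_ne_zero]⟩) (by
      refine ⟨fun i j h => ?_, fun v => ?_⟩
      · simpa using h
      · obtain ⟨v, hv⟩ := v
        obtain ⟨i, rfl⟩ := x.surjective v
        have hi : i ≠ 0 := by simpa using hv
        obtain ⟨j, rfl⟩ := Fin.exists_succ_eq.2 hi
        exact ⟨j, rfl⟩)
  have he : ∀ i, (e i : V) = x i.succ := fun _ => rfl
  rw [← det_submatrix_equiv_self e,
    show ((reducedLaplacian G x).det : ℝ) = Int.castRingHom ℝ (reducedLaplacian G x).det from rfl,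
    RingHom.map_det]
  congr 1
  ext i j
  simp only [reducedLaplacian, dirichletLaplacian, SimpleGraph.lapMatrix, he,
    RingHom.mapMatrix_apply, map_apply, submatrix_apply, Matrix.sub_apply, SimpleGraph.degMatrix,
    SimpleGraph.adjMatrix_apply, diagonal_apply]
  rw [map_sub]
  congr 1 <;> split_ifs <;> simp

end DirichletLaplacian

/-! ### Loop-erasure and paths stopped in a set -/

section LoopErasure

variable {V : Type*}

/-- `IsBranch G S p` says that `p` is a self-avoiding path in `G` whose last vertex, and no other,
lies in `S`: the shape of the paths which are added to the tree `S`. -/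
inductive IsBranch (G : SimpleGraph V) (S : Finset V) : List V → Prop
  | root {s : V} : s ∈ S → IsBranch G S [s]
  | cons {a b : V} {l : List V} :
      a ∉ S → G.Adj a b → a ∉ b :: l → IsBranch G S (b :: l) → IsBranch G S (a :: b :: l)

theorem IsBranch.exists_getLast {G : SimpleGraph V} {S : Finset V} {p : List V}
    (h : IsBranch G S p) : ∃ s ∈ p, s ∈ S ∧ p.getLast? = some s := by
  induction h with
  | @root s hs => exact ⟨s, by simp, hs, rfl⟩
  | cons _ _ _ _ ih =>
    obtain ⟨s, hs, hsS, h⟩ := ih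
    exact ⟨s, List.mem_cons_of_mem _ hs, hsS, by simpa using h⟩

variable [DecidableEq V]

theorem loopErase_nil : loopErase ([] : List V) = [] := by rw [loopErase]

theorem loopErase_cons (a : V) (l : List V) :
    loopErase (a :: l) = a :: loopErase (l.rtakeWhile fun b => b ≠ a) := by rw [loopErase]

theorem rtakeWhile_cons_self (a : V) (l : List V) :
    (a :: l).rtakeWhile (fun b => b ≠ a) = l.rtakeWhile fun b => b ≠ a := by
  simp only [List.rtakeWhile, List.reverse_cons, List.takeWhile_append]
  split_ifs with h
  · rw [(List.takeWhile_prefix (fun b => decide (b ≠ a)) (l := l.reverse)).eq_of_length h]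
    simp
  · rfl

theorem rtakeWhile_cons_of_mem {a : V} (u : V) {l : List V} (h : a ∈ l) :
    (u :: l).rtakeWhile (fun b => b ≠ a) = l.rtakeWhile fun b => b ≠ a := by
  simp only [List.rtakeWhile, List.reverse_cons, List.takeWhile_append]
  rw [if_neg]
  intro hlen
  have := (List.takeWhile_prefix (fun b => decide (b ≠ a)) (l := l.reverse)).eq_of_length hlen
  rw [List.takeWhile_eq_self_iff] at this
  simpa using this a (by simpa using h)

theorem rtakeWhile_of_notMem {a : V} {l : List V} (h : a ∉ l) :
    (l.rtakeWhile fun b => b ≠ a) = l := by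
  rw [List.rtakeWhile_eq_self_iff]
  intro x hx
  simpa using ne_of_mem_of_not_mem hx h

/-- What follows the last visit to `a` is preceded by a visit to `a`. -/
theorem cons_rtakeWhile_suffix (a : V) (l : List V) :
    (a :: l.rtakeWhile fun b => b ≠ a) <:+ a :: l := by
  have h := List.rdropWhile_append_rtakeWhile (p := fun b => decide (b ≠ a)) (l := l)
  by_cases h0 : (l.rdropWhile fun b => b ≠ a) = []
  · rw [h0, List.nil_append] at h
    rw [h]
  · have hlast := List.rdropWhile_last_not (fun b => decide (b ≠ a)) l h0
    have hlast' : (l.rdropWhile fun b => b ≠ a).getLast h0 = a := by simpa using hlast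
    refine ⟨a :: (l.rdropWhile fun b => b ≠ a).dropLast, ?_⟩
    conv_rhs => rw [← h, ← List.dropLast_append_getLast h0, hlast']
    simp

theorem head?_loopErase (l : List V) : (loopErase l).head? = l.head? := by
  cases l with
  | nil => rw [loopErase_nil]
  | cons a l => rw [loopErase_cons]; rfl

theorem getLast?_loopErase (l : List V) : (loopErase l).getLast? = l.getLast? := by
  induction h : l.length using Nat.strong_induction_on generalizing l with
  | _ n ih =>
    cases l with
    | nil => rw [loopErase_nil]
    | cons a l =>
      have hlen := (List.rtakeWhile_suffix (fun b => decide (b ≠ a)) l).length_le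
      rw [List.length_cons] at h
      have ih' := ih _ (by omega) (l.rtakeWhile fun b => b ≠ a) rfl
      obtain ⟨t, ht⟩ := cons_rtakeWhile_suffix a l
      rw [loopErase_cons, ← ht, List.getLast?_append, List.getLast?_cons, ih', List.getLast?_cons]
      simp

theorem mem_of_mem_loopErase {l : List V} {x : V} (hx : x ∈ loopErase l) : x ∈ l := by
  induction h : l.length using Nat.strong_induction_on generalizing l with
  | _ n ih =>
    cases l with
    | nil => simp [loopErase_nil] at hx
    | cons a l =>
      have hsuf := List.rtakeWhile_suffix (fun b => decide (b ≠ a)) l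
      have hlen := hsuf.length_le
      rw [List.length_cons] at h
      rw [loopErase_cons, List.mem_cons] at hx
      rcases hx with rfl | hx
      · simp
      · exact List.mem_cons_of_mem _ (hsuf.subset (ih _ (by omega) hx rfl))

theorem IsBranch.insert {G : SimpleGraph V} {S : Finset V} {p : List V} (h : IsBranch G S p)
    {a : V} (ha : a ∉ p) : IsBranch G (insert a S) p := by
  induction h with
  | root hs => exact .root (Finset.mem_insert_of_mem hs)
  | cons hb hbc hbl _ ih =>
    rw [List.mem_cons, not_or] at ha
    refine .cons (fun h => ?_) hbc hbl (ih ha.2)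
    exact (Finset.mem_insert.1 h).elim (fun h => ha.1 h.symm) hb

/-- The loop-erasure of a path run until it hits `S` is a branch. -/
theorem isBranch_loopErase {G : SimpleGraph V} {S : Finset V} (l : List V) {s : V} (hs : s ∈ S)
    (hl : ∀ x ∈ l, x ∉ S) (hchain : (l ++ [s]).IsChain G.Adj) :
    IsBranch G S (loopErase (l ++ [s])) := by
  induction h : l.length using Nat.strong_induction_on generalizing l with
  | _ n ih =>
    cases l with
    | nil => simpa [loopErase_cons, loopErase_nil] using IsBranch.root hs
    | cons a l =>
      have ha : a ∉ S := hl a (by simp)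
      have hsa : s ≠ a := fun h => ha (h ▸ hs)
      have e : ((l ++ [s]).rtakeWhile fun b => b ≠ a)
          = (l.rtakeWhile fun b => b ≠ a) ++ [s] :=
        List.rtakeWhile_concat_pos _ _ _ (by simpa using hsa)
      have hsuf := cons_rtakeWhile_suffix a (l ++ [s])
      have hlsuf := List.rtakeWhile_suffix (fun b => decide (b ≠ a)) l
      have hch : (a :: ((l.rtakeWhile fun b => b ≠ a) ++ [s])).IsChain G.Adj := by
        rw [← e]
        exact List.IsChain.suffix hchain hsuf
      have hlen := hlsuf.length_le
      rw [List.length_cons] at h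
      have ih' := ih _ (by omega) (l.rtakeWhile fun b => b ≠ a)
        (fun x hx => hl x (List.mem_cons_of_mem _ (hlsuf.subset hx))) hch.tail rfl
      have hmem : ∀ x ∈ loopErase ((l.rtakeWhile fun b => b ≠ a) ++ [s]), x ≠ a := by
        intro x hx
        rw [← e] at hx
        simpa using List.mem_rtakeWhile_imp (mem_of_mem_loopErase hx)
      rw [List.cons_append, loopErase_cons, e]
      have hhead := head?_loopErase ((l.rtakeWhile fun b => b ≠ a) ++ [s])
      revert hhead ih' hmem
      cases hE : loopErase ((l.rtakeWhile fun b => b ≠ a) ++ [s]) with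
      | nil => intro ih'; cases ih'
      | cons b r =>
        intro ih' hmem hhead
        refine .cons ha ?_ (fun h => hmem a h rfl) ih'
        cases hr : (l.rtakeWhile fun b => b ≠ a) ++ [s] with
        | nil => simp at hr
        | cons c r' =>
          rw [hr] at hch hhead
          obtain rfl : b = c := by simpa using hhead
          exact (List.isChain_cons_cons.1 hch).1

end LoopErasure

section RunUntil

variable {V : Type*} [DecidableEq V] {S : Finset V} {w : ℕ → V}

theorem runUntil_eq_some_iff {p : List V} :
    runUntil S w = some p ↔
      ∃ k, (List.range (k + 1)).map w = p ∧ w k ∈ S ∧ ∀ i < k, w i ∉ S := by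
  classical
  unfold runUntil
  constructor
  · intro h
    split_ifs at h with hex
    exact ⟨_, Option.some.inj h, Nat.find_spec hex, fun i hi => Nat.find_min hex hi⟩
  · rintro ⟨k, rfl, hk, hlt⟩
    have hex : ∃ k, w k ∈ S := ⟨k, hk⟩
    have hfind : Nat.find hex = k := by
      rw [Nat.find_eq_iff]
      exact ⟨hk, hlt⟩
    rw [dif_pos hex]
    congr! 4

theorem exists_runUntil_iff : (∃ p, runUntil S w = some p) ↔ ∃ k, w k ∈ S := by
  unfold runUntil
  split_ifs with h <;> simp [h]

theorem runUntil_of_mem (h : w 0 ∈ S) : runUntil S w = some [w 0] :=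
  runUntil_eq_some_iff.2 ⟨0, by simp, h, by simp⟩

theorem head?_of_runUntil {p : List V} (h : runUntil S w = some p) : p.head? = some (w 0) := by
  obtain ⟨k, rfl, -⟩ := runUntil_eq_some_iff.1 h
  simp [List.range_succ_eq_map]

theorem runUntil_consWalk_eq_some_iff {v : V} (hv : v ∉ S) {p : List V} :
    runUntil S (consWalk v w) = some p ↔ ∃ q, runUntil S w = some q ∧ v :: q = p := by
  simp only [runUntil_eq_some_iff]
  constructor
  · rintro ⟨k, rfl, hk, hlt⟩
    cases k with
    | zero => exact absurd hk hv
    | succ k =>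
      refine ⟨_, ⟨k, rfl, hk, fun i hi => hlt (i + 1) (by omega)⟩, ?_⟩
      rw [List.range_succ_eq_map (n := k + 1), List.map_cons, List.map_map]
      rfl
  · rintro ⟨_, ⟨k, rfl, hk, hlt⟩, rfl⟩
    refine ⟨k + 1, ?_, hk, fun i hi => ?_⟩
    · rw [List.range_succ_eq_map (n := k + 1), List.map_cons, List.map_map]
      rfl
    · cases i with
      | zero => exact hv
      | succ i => exact hlt i (by omega)

/-- Running until `S` without visiting `a` is the same as running until `S ∪ {a}` and not ending
in `a`. -/
theorem runUntil_and_notMem_iff {a : V} {p : List V} :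
    runUntil S w = some p ∧ a ∉ p ↔
      runUntil (insert a S) w = some p ∧ p.getLast? ≠ some a := by
  simp only [runUntil_eq_some_iff]
  constructor
  · rintro ⟨⟨k, rfl, hk, hlt⟩, ha⟩
    have ha' : ∀ i ≤ k, w i ≠ a := fun i hi h =>
      ha (List.mem_map.2 ⟨i, List.mem_range.2 (by omega), h⟩)
    refine ⟨⟨k, rfl, Finset.mem_insert_of_mem hk, fun i hi h => ?_⟩, ?_⟩
    · exact (Finset.mem_insert.1 h).elim (ha' i hi.le) (hlt i hi)
    · simpa [List.range_succ] using ha' k le_rfl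
  · rintro ⟨⟨k, rfl, hk, hlt⟩, ha⟩
    have hka : w k ≠ a := by simpa [List.range_succ] using ha
    refine ⟨⟨k, rfl, (Finset.mem_insert.1 hk).resolve_left hka,
      fun i hi h => hlt i hi (Finset.mem_insert_of_mem h)⟩, fun h => ?_⟩
    obtain ⟨i, hi, rfl⟩ := List.mem_map.1 h
    have hi' := List.mem_range.1 hi
    rcases Nat.lt_or_ge i k with hik | hik
    · exact hlt i hik (Finset.mem_insert_self _ _)
    · exact hka (by congr 1; omega)

theorem isBranch_of_runUntil {G : SimpleGraph V}
    (hw : ∀ k, G.Adj (w k) (w (k + 1))) {p : List V} (h : runUntil S w = some p) :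
    IsBranch G S (loopErase p) := by
  obtain ⟨k, rfl, hk, hlt⟩ := runUntil_eq_some_iff.1 h
  rw [List.range_succ, List.map_append, List.map_singleton]
  refine isBranch_loopErase _ hk (fun x hx => ?_) ?_
  · obtain ⟨i, hi, rfl⟩ := List.mem_map.1 hx
    exact hlt i (List.mem_range.1 hi)
  · rw [← List.map_singleton (f := w), ← List.map_append, ← List.range_succ, List.isChain_map,
      List.isChain_iff_getElem]
    intro i hi
    simpa using hw i

variable [Finite V] [MeasurableSpace V] [MeasurableSingletonClass V]

theorem measurableSet_exists_runUntil (S : Finset V) (φ : List V → Prop) :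
    MeasurableSet {w : ℕ → V | ∃ p, runUntil S w = some p ∧ φ p} := by
  have hw : ∀ k (A : Set V), MeasurableSet {w : ℕ → V | w k ∈ A} := fun k A =>
    measurableSet_preimage (measurable_pi_apply k) A.toFinite.measurableSet
  have hmap : ∀ m (p : List V), MeasurableSet {w : ℕ → V | (List.range m).map w = p} := by
    intro m p
    simp only [List.map_eq_iff, Set.ofPred_forall]
    refine MeasurableSet.iInter fun i => ?_
    cases (List.range m)[i]? with
    | none => simp
    | some j =>
      cases p[i]? with
      | none => simp
      | some q => simpa [eq_comm] using hw j {q}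
  have : {w : ℕ → V | ∃ p, runUntil S w = some p ∧ φ p}
      = ⋃ p, ⋃ (_ : φ p), ⋃ k, {w : ℕ → V | (List.range (k + 1)).map w = p}
        ∩ ({w | w k ∈ S} ∩ ⋂ i, ⋂ (_ : i < k), {w | w i ∉ S}) := by
    ext w
    simp only [runUntil_eq_some_iff, Set.mem_ofPred_eq, Set.mem_iUnion, Set.mem_inter_iff,
      Set.mem_iInter, exists_prop]
    exact ⟨fun ⟨p, h, hp⟩ => ⟨p, hp, h⟩, fun ⟨p, hp, h⟩ => ⟨p, h, hp⟩⟩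
  rw [this]
  exact MeasurableSet.iUnion fun p => MeasurableSet.iUnion fun _ => MeasurableSet.iUnion fun k =>
    (hmap _ p).inter ((hw k S).inter (MeasurableSet.iInter fun i => MeasurableSet.iInter fun _ =>
      hw i (S : Set V)ᶜ))

end RunUntil

/-! ### Hitting probabilities and the law of the loop-erasure -/

section HittingLaw

variable {V : Type*} [Fintype V] [DecidableEq V] [MeasurableSpace V] [MeasurableSingletonClass V]
  {G : SimpleGraph V} [DecidableRel G.Adj]

/-- The walk almost surely hits `S`: the probability of never hitting `S` vanishes on `S` and is
harmonic off `S`. -/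
theorem ae_exists_mem (hG : G.Connected) (hdeg : ∀ v, 0 < G.degree v) {S : Finset V}
    (hS : S.Nonempty) (v : V) : ∀ᵐ w ∂srwLaw G v, ∃ k, w k ∈ S := by
  have hA : MeasurableSet {w : ℕ → V | ¬ ∃ k, w k ∈ S} := by
    have := measurableSet_exists_runUntil S fun _ => True
    simp only [and_true, exists_runUntil_iff] at this
    exact this.compl
  have hzero := eq_zero_of_harmonic hG hS
    (f := fun v => (srwLaw G v).real {w | ¬ ∃ k, w k ∈ S})
    (fun s hs => srwLaw_real_eq_zero fun w hw h0 => hw ⟨0, by rwa [h0]⟩)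
    (fun u hu => by
      have hpre : consWalk u ⁻¹' {w | ¬ ∃ k, w k ∈ S} = {w | ¬ ∃ k, w k ∈ S} := by
        ext w
        refine not_congr ⟨fun ⟨k, hk⟩ => ?_, fun ⟨k, hk⟩ => ⟨k + 1, hk⟩⟩
        cases k with
        | zero => exact absurd hk hu
        | succ k => exact ⟨k, hk⟩
      rw [degree_mul_srwLaw_real G u (hdeg u) hA, hpre]) v
  exact ae_iff.2 ((measureReal_eq_zero_iff (measure_ne_top _ _)).1 hzero)

/-- The law of the loop-erasure of the walk run until it hits `S`: the branch `a :: l` has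
probability `det Δ_{S ∪ (a :: l)} / det Δ_S`, where `Δ_S` is the Laplacian with Dirichlet condition
on `S`.

If `a ∉ S`, consider the probability `f u` that the walk from `u` visits `a` before `S` and that
its path from the last visit to `a` on has loop-erasure `a :: l`. It vanishes on `S`, is harmonic
off `S ∪ {a}`, and its Laplacian at `a` is the probability that the walk from the second vertex `b`
of the branch, run until it hits `S ∪ {a}`, has loop-erasure `l`. Cramer's rule gives `f a`. -/
theorem srwLaw_loopErase_mul_det (hdeg : ∀ v, 0 < G.degree v) {a : V}
    {l : List V} {S : Finset V} (h : IsBranch G S (a :: l)) :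
    (srwLaw G a).real {w | ∃ p, runUntil S w = some p ∧ loopErase p = a :: l}
        * (dirichletLaplacian G S).det
      = (dirichletLaplacian G (S ∪ (a :: l).toFinset)).det := by
  induction l generalizing a S with
  | nil =>
    cases h with
    | root ha =>
      have hprob : (srwLaw G a).real {w | ∃ p, runUntil S w = some p ∧ loopErase p = [a]} = 1 := by
        rw [← probReal_univ (μ := srwLaw G a)]
        refine measureReal_congr (Filter.eventuallyEq_univ.2 ?_)
        filter_upwards [ae_srwLaw_start G a] with w hw
        exact ⟨[a], by rw [runUntil_of_mem (by rwa [hw]), hw],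
          by rw [loopErase_cons, List.rtakeWhile_nil, loopErase_nil]⟩
      rw [hprob, one_mul, List.toFinset_cons, List.toFinset_nil, insert_empty_eq,
        Finset.union_eq_left.2 (by simpa using ha)]
  | cons b l ih =>
    cases h with
    | cons ha hab hal hbl =>
    obtain ⟨s, hs, hsS, hlast⟩ := hbl.exists_getLast
    have hsa : s ≠ a := fun h => ha (h ▸ hsS)
    -- `E`: the path visits `a`, and after its last visit to `a` it has loop-erasure `b :: l`;
    -- `E'`: the path avoids `a` and has loop-erasure `b :: l`
    let E : Set (ℕ → V) :=
      {w | ∃ p, runUntil S w = some p ∧ a ∈ p ∧ loopErase (p.rtakeWhile fun c => c ≠ a) = b :: l}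
    let E' : Set (ℕ → V) := {w | ∃ p, runUntil S w = some p ∧ a ∉ p ∧ loopErase p = b :: l}
    have hE : MeasurableSet E := measurableSet_exists_runUntil S _
    have hE' : MeasurableSet E' := measurableSet_exists_runUntil S _
    have hEE' : Disjoint E E' := by
      rw [Set.disjoint_left]
      rintro w ⟨p, hp, hap, -⟩ ⟨q, hq, haq, -⟩
      rw [hp] at hq
      exact haq (Option.some.inj hq ▸ hap)
    have hcramer := mul_det_of_laplacian_eq_single (G := G) ha
      (f := fun u => (srwLaw G u).real E) (c := (srwLaw G b).real E')
      (fun u hu => srwLaw_real_eq_zero fun w hw h0 => by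
        obtain ⟨p, hp, hap, -⟩ := hw
        rw [runUntil_of_mem (by rwa [h0]), h0, Option.some.injEq] at hp
        rw [← hp, List.mem_singleton] at hap
        exact ha (hap ▸ hu))
      (fun u hu hua => by
        rw [degree_mul_srwLaw_real G u (hdeg u) hE]
        suffices hpre : consWalk u ⁻¹' E = E by rw [hpre]
        ext w
        simp only [E, Set.mem_preimage, Set.mem_ofPred_eq, runUntil_consWalk_eq_some_iff hu]
        constructor
        · rintro ⟨_, ⟨q, hq, rfl⟩, haq, hl⟩
          have haq' : a ∈ q := (List.mem_cons.1 haq).resolve_left hua.symm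
          exact ⟨q, hq, haq', by rwa [rtakeWhile_cons_of_mem u haq'] at hl⟩
        · rintro ⟨q, hq, haq, hl⟩
          exact ⟨_, ⟨q, hq, rfl⟩, List.mem_cons_of_mem _ haq,
            by rwa [rtakeWhile_cons_of_mem u haq]⟩)
      (by
        -- after the first step the walk from `a` either returns to `a` or has left it for good
        have hpre : consWalk a ⁻¹' E = E ∪ E' := by
          ext w
          simp only [E, E', Set.mem_preimage, Set.mem_union, Set.mem_ofPred_eq,
            runUntil_consWalk_eq_some_iff ha]
          constructor
          · rintro ⟨_, ⟨q, hq, rfl⟩, -, hl⟩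
            rw [rtakeWhile_cons_self] at hl
            by_cases haq : a ∈ q
            · exact Or.inl ⟨q, hq, haq, hl⟩
            · exact Or.inr ⟨q, hq, haq, by rwa [rtakeWhile_of_notMem haq] at hl⟩
          · rintro (⟨q, hq, haq, hl⟩ | ⟨q, hq, haq, hl⟩)
            · exact ⟨_, ⟨q, hq, rfl⟩, by simp, by rwa [rtakeWhile_cons_self]⟩
            · exact ⟨_, ⟨q, hq, rfl⟩, by simp,
                by rwa [rtakeWhile_cons_self, rtakeWhile_of_notMem haq]⟩
        rw [degree_mul_srwLaw_real G a (hdeg a) hE, hpre]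
        have hadd : ∀ y, (srwLaw G y).real (E ∪ E') = (srwLaw G y).real E + (srwLaw G y).real E' :=
          fun y => measureReal_union hEE' hE'
        simp only [hadd, Finset.sum_add_distrib]
        congr 1
        -- loop-erasure keeps the starting point, so only the neighbour `b` contributes to `E'`
        refine Finset.sum_eq_single_of_mem b (by simpa using hab) fun y _ hy => ?_
        refine srwLaw_real_eq_zero fun w hw h0 => hy ?_
        obtain ⟨p, hp, -, hl⟩ := hw
        have h1 := head?_loopErase p
        rw [hl, head?_of_runUntil hp, h0] at h1
        simpa [eq_comm] using h1)
    have hEeq : (srwLaw G a).real {w | ∃ p, runUntil S w = some p ∧ loopErase p = a :: b :: l}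
        = (srwLaw G a).real E := by
      refine measureReal_congr ?_
      filter_upwards [ae_srwLaw_start G a] with w hw
      refine propext (exists_congr fun p => and_congr_right fun hp => ?_)
      have h1 := head?_of_runUntil hp
      cases p with
      | nil => simp at h1
      | cons c p =>
        obtain rfl : c = a := by simpa [hw] using h1
        rw [loopErase_cons, rtakeWhile_cons_self, List.cons_inj_right]
        simp
    -- the branch `b :: l` does not end in `a`, so `E'` is the event of the induction hypothesis
    have hE'eq : E' = {w | ∃ p, runUntil (insert a S) w = some p ∧ loopErase p = b :: l} := by
      ext w
      refine exists_congr fun p => ?_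
      rw [← and_assoc, runUntil_and_notMem_iff, and_assoc]
      refine and_congr_right fun _ => ⟨And.right, fun h => ⟨?_, h⟩⟩
      rw [← getLast?_loopErase, h, hlast]
      simpa using hsa
    have hunion : S ∪ (a :: b :: l).toFinset = insert a S ∪ (b :: l).toFinset := by
      rw [List.toFinset_cons (a := a), Finset.union_insert, Finset.insert_union]
    rw [hEeq, hcramer, hE'eq, ih (hbl.insert hal), hunion]

end HittingLaw

/-! ### Branches, subtrees and the rounds of the algorithm -/

section Trees

variable {V : Type*} {G T : SimpleGraph V} {S : Finset V}

theorem traversedEdges_singleton (s : V) : traversedEdges [s] = ⊥ := by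
  simp [traversedEdges]

theorem traversedEdges_cons_cons (a b : V) (l : List V) :
    traversedEdges (a :: b :: l) = traversedEdges (b :: l) ⊔ SimpleGraph.edge a b := by
  rw [traversedEdges, traversedEdges, SimpleGraph.edge, ← SimpleGraph.fromEdgeSet_union]
  congr 1
  ext e
  simp [or_comm]

theorem IsBranch.traversedEdges_le {p : List V} (h : IsBranch T S p) : traversedEdges p ≤ T := by
  induction h with
  | root => simp [traversedEdges_singleton]
  | cons _ hab _ _ ih =>
    rw [traversedEdges_cons_cons]
    exact sup_le ih ((SimpleGraph.edge_le_iff _).2 (Or.inr hab))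

theorem IsBranch.of_traversedEdges_le {p : List V} (h : IsBranch G S p)
    (hT : traversedEdges p ≤ T) : IsBranch T S p := by
  induction h with
  | root hs => exact .root hs
  | cons ha hab hal _ ih =>
    rw [traversedEdges_cons_cons] at hT
    have hT' := sup_le_iff.1 hT
    exact .cons ha (((SimpleGraph.edge_le_iff _).1 hT'.2).resolve_left hab.ne) hal (ih hT'.1)

/-- A path to a point of `S`, stopped when it enters `S`, is a branch. -/
theorem exists_isBranch_of_isPath {v r : V} (hr : r ∈ S) (p : T.Walk v r) (hp : p.IsPath) :
    ∃ l, IsBranch T S (v :: l) ∧ ∀ x ∈ v :: l, x ∈ p.support := by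
  induction p with
  | nil => exact ⟨[], .root hr, by simp⟩
  | @cons v u r hvu p ih =>
    by_cases hv : v ∈ S
    · exact ⟨[], .root hv, by simp⟩
    · obtain ⟨l, hl, hsub⟩ := ih hr hp.of_cons
      rw [SimpleGraph.Walk.cons_isPath_iff] at hp
      refine ⟨u :: l, .cons hv hvu (fun h => hp.2 (hsub v h)) hl, fun x hx => ?_⟩
      rw [SimpleGraph.Walk.support_cons]
      exact (List.mem_cons.1 hx).elim (fun h => h ▸ List.mem_cons_self)
        fun h => List.mem_cons_of_mem _ (hsub x h)

/-- If `S` is connected to `r` inside `S`, then a branch extends to a path to `r`. -/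
theorem IsBranch.exists_isPath {r : V}
    (hS : ∀ s ∈ S, ∃ p : T.Walk s r, p.IsPath ∧ ∀ x ∈ p.support, x ∈ S) {v : V} {l : List V}
    (h : IsBranch T S (v :: l)) :
    ∃ p : T.Walk v r, p.IsPath ∧ ∀ x ∈ p.support, x ∈ S ∨ x ∈ v :: l := by
  induction l generalizing v with
  | nil =>
    cases h with
    | root hs =>
      obtain ⟨p, hp, hpS⟩ := hS v hs
      exact ⟨p, hp, fun x hx => Or.inl (hpS x hx)⟩
  | cons b l ih =>
    cases h with
    | cons ha hab hal hbl =>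
      obtain ⟨p, hp, hpS⟩ := ih hbl
      refine ⟨.cons hab p, (SimpleGraph.Walk.cons_isPath_iff _ _).2
        ⟨hp, fun h => (hpS v h).elim ha hal⟩, fun x hx => ?_⟩
      rw [SimpleGraph.Walk.support_cons, List.mem_cons] at hx
      rcases hx with rfl | hx
      · simp
      · exact (hpS x hx).imp_right (List.mem_cons_of_mem _)

/-- In an acyclic graph there is at most one branch from a vertex to a connected set. -/
theorem IsBranch.eq_of_isAcyclic (hT : T.IsAcyclic) {r : V}
    (hS : ∀ s ∈ S, ∃ p : T.Walk s r, p.IsPath ∧ ∀ x ∈ p.support, x ∈ S) {v : V}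
    {l l' : List V} (h : IsBranch T S (v :: l)) (h' : IsBranch T S (v :: l')) : l = l' := by
  induction l generalizing v l' with
  | nil =>
    cases h with
    | root hv =>
      cases h' with
      | root => rfl
      | cons hv' => exact absurd hv hv'
  | cons b l ih =>
    cases h with
    | cons hv hb hbl hl =>
      cases h' with
      | root hv' => exact absurd hv' hv
      | @cons _ c l' _ hc hcl hl' =>
        obtain ⟨p, hp, hpS⟩ := hl.exists_isPath hS
        obtain ⟨q, hq, hqS⟩ := hl'.exists_isPath hS
        have hp' : (SimpleGraph.Walk.cons hb p).IsPath :=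
          (SimpleGraph.Walk.cons_isPath_iff _ _).2 ⟨hp, fun h => (hpS v h).elim hv hbl⟩
        have hq' : (SimpleGraph.Walk.cons hc q).IsPath :=
          (SimpleGraph.Walk.cons_isPath_iff _ _).2 ⟨hq, fun h => (hqS v h).elim hv hcl⟩
        have hpq := congrArg (fun p => p.1.snd) 
          ((hT.subsingleton_path v r).elim ⟨_, hp'⟩ ⟨_, hq'⟩)
        obtain rfl : b = c := by simpa using hpq
        rw [ih hl hl']

/-- The invariant of Wilson's algorithm: `t` is a subtree of `G` which contains the vertex `r`. -/
structure IsPartialTree (G : SimpleGraph V) (r : V) (t : PartialTree V) : Prop where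
  root_mem : r ∈ t.verts
  le : t.graph ≤ G
  mem_of_adj : ∀ {u v}, t.graph.Adj u v → u ∈ t.verts
  reachable : ∀ v ∈ t.verts, t.graph.Reachable v r
  isAcyclic : t.graph.IsAcyclic

namespace IsPartialTree

variable {r : V} {t : PartialTree V}

theorem singleton (G : SimpleGraph V) (r : V) : IsPartialTree G r ⟨{r}, ⊥⟩ where
  root_mem := by simp
  le := bot_le
  mem_of_adj h := by simp at h
  reachable v hv := by rw [Finset.mem_singleton.1 hv]
  isAcyclic := SimpleGraph.isAcyclic_bot

theorem support_subset (ht : IsPartialTree G r t) {u v : V} (p : t.graph.Walk u v)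
    (hu : u ∈ t.verts) : ∀ x ∈ p.support, x ∈ t.verts := by
  induction p with
  | nil => simpa using hu
  | cons h p ih =>
    intro x hx
    rw [SimpleGraph.Walk.support_cons, List.mem_cons] at hx
    rcases hx with rfl | hx
    · exact hu
    · exact ih (ht.mem_of_adj h.symm) x hx

theorem exists_isPath (ht : IsPartialTree G r t) (hT : t.graph ≤ T) :
    ∀ s ∈ t.verts, ∃ p : T.Walk s r, p.IsPath ∧ ∀ x ∈ p.support, x ∈ t.verts := by
  intro s hs
  obtain ⟨p, hp⟩ := (ht.reachable s hs).exists_isPath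
  refine ⟨p.mapLe hT, hp.mapLe hT, fun x hx => ?_⟩
  rw [SimpleGraph.Walk.support_mapLe_eq_support] at hx
  exact ht.support_subset p hs x hx

theorem connected (ht : IsPartialTree G r t) (huniv : ∀ v, v ∈ t.verts) : t.graph.Connected where
  preconnected u v := (ht.reachable u (huniv u)).trans (ht.reachable v (huniv v)).symm
  nonempty := ⟨r⟩

theorem graph_mem_spanningTrees (ht : IsPartialTree G r t) (huniv : ∀ v, v ∈ t.verts) :
    t.graph ∈ spanningTrees G :=
  ⟨ht.le, ht.connected huniv, ht.isAcyclic⟩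

/-- A subtree on all vertices which lies below a tree `T` is `T`, since trees are minimally
connected. -/
theorem graph_eq (ht : IsPartialTree G r t) (huniv : ∀ v, v ∈ t.verts) (hT : T.IsTree)
    (hle : t.graph ≤ T) : t.graph = T :=
  le_antisymm hle ((SimpleGraph.isTree_iff_minimal_connected.1 hT).2 (ht.connected huniv) hle)

variable [DecidableEq V]

/-- Attaching a new leaf `a` to a subtree gives a subtree. -/
theorem insert (ht : IsPartialTree G r t) {a b : V} (ha : a ∉ t.verts) (hb : b ∈ t.verts)
    (hab : G.Adj a b) :
    IsPartialTree G r ⟨insert a t.verts, t.graph ⊔ SimpleGraph.edge a b⟩ where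
  root_mem := Finset.mem_insert_of_mem ht.root_mem
  le := sup_le ht.le ((SimpleGraph.edge_le_iff _).2 (Or.inr hab))
  mem_of_adj {u v} h := by
    rw [SimpleGraph.sup_adj, SimpleGraph.edge_adj] at h
    rcases h with h | ⟨⟨rfl, rfl⟩ | ⟨rfl, rfl⟩, -⟩
    · exact Finset.mem_insert_of_mem (ht.mem_of_adj h)
    · exact Finset.mem_insert_self _ _
    · exact Finset.mem_insert_of_mem hb
  reachable v hv := by
    have hmono : ∀ v ∈ t.verts, (t.graph ⊔ SimpleGraph.edge a b).Reachable v r :=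
      fun v hv => (ht.reachable v hv).mono le_sup_left
    rcases Finset.mem_insert.1 hv with rfl | hv
    · refine SimpleGraph.Reachable.trans (SimpleGraph.Adj.reachable ?_) (hmono b hb)
      exact Or.inr ((SimpleGraph.edge_adj ..).2 ⟨Or.inl ⟨rfl, rfl⟩, hab.ne⟩)
    · exact hmono v hv
  isAcyclic := by
    refine SimpleGraph.IsAcyclic.sup_edge_of_not_reachable ?_ ht.isAcyclic
    rintro ⟨p⟩
    cases p with
    | nil => exact ha hb
    | cons h _ => exact ha (ht.mem_of_adj h)

end IsPartialTree

variable [DecidableEq V]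

/-- The result of adding the vertices and edges of the path `p` to `t`. -/
def PartialTree.addPath (t : PartialTree V) (p : List V) : PartialTree V where
  verts := t.verts ∪ p.toFinset
  graph := t.graph ⊔ traversedEdges p

theorem IsPartialTree.addPath {r : V} {t : PartialTree V} (ht : IsPartialTree G r t) {p : List V}
    (hp : IsBranch G t.verts p) : IsPartialTree G r (t.addPath p) := by
  induction hp with
  | @root s hs =>
    have : t.addPath [s] = t := by
      simp [PartialTree.addPath, traversedEdges_singleton, hs]
    rwa [this]
  | @cons a b l ha hab hal _ ih =>
    have : t.addPath (a :: b :: l) = ⟨Insert.insert a (t.addPath (b :: l)).verts,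
        (t.addPath (b :: l)).graph ⊔ SimpleGraph.edge a b⟩ := by
      simp only [PartialTree.addPath, traversedEdges_cons_cons, sup_assoc]
      rw [List.toFinset_cons (a := a), Finset.union_insert]
    rw [this]
    refine ih.insert ?_ ?_ hab
    · simpa [PartialTree.addPath, ha] using hal
    · simp [PartialTree.addPath]

theorem wilsonRound_of_mem {t : PartialTree V} {v : V} (hv : v ∈ t.verts) (w : ℕ → V) :
    wilsonRound t v w = some t := if_pos hv

theorem wilsonRound_of_notMem {t : PartialTree V} {v : V} (hv : v ∉ t.verts) (w : ℕ → V) :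
    wilsonRound t v w = (runUntil t.verts w).map fun p => t.addPath (loopErase p) := if_neg hv

theorem graph_le_of_foldlM {n : ℕ} {x : Fin (n + 1) → V} {w : Fin n → ℕ → V} {js : List (Fin n)}
    {t t' : PartialTree V}
    (h : js.foldlM (fun t j => wilsonRound t (x j.succ) (w j)) t = some t') :
    t.graph ≤ t'.graph := by
  induction js generalizing t with
  | nil => exact (Option.some.inj h) ▸ le_rfl
  | cons j js ih =>
    rw [List.foldlM_cons, Option.bind_eq_bind, Option.bind_eq_some_iff] at h
    obtain ⟨t₁, h₁, h⟩ := h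
    refine le_trans ?_ (ih h)
    by_cases hv : x j.succ ∈ t.verts
    · rw [wilsonRound_of_mem hv] at h₁
      exact (Option.some.inj h₁) ▸ le_rfl
    · rw [wilsonRound_of_notMem hv, Option.map_eq_some_iff] at h₁
      obtain ⟨p, -, rfl⟩ := h₁
      exact le_sup_left

/-- If the walks move along edges of `G` and hit every nonempty set, then the algorithm produces a
subtree of `G` which contains the starting points of all walks. -/
theorem exists_foldlM_eq_some {n : ℕ} {x : Fin (n + 1) → V} {w : Fin n → ℕ → V} {r : V}
    (hstart : ∀ j, w j 0 = x j.succ) (hadj : ∀ j k, G.Adj (w j k) (w j (k + 1)))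
    (hhit : ∀ j (S : Finset V), S.Nonempty → ∃ k, w j k ∈ S) (js : List (Fin n))
    {t : PartialTree V} (ht : IsPartialTree G r t) :
    ∃ t', js.foldlM (fun t j => wilsonRound t (x j.succ) (w j)) t = some t' ∧
      IsPartialTree G r t' ∧ t.verts ⊆ t'.verts ∧ ∀ j ∈ js, x j.succ ∈ t'.verts := by
  induction js generalizing t with
  | nil => exact ⟨t, rfl, ht, subset_rfl, by simp⟩
  | cons j js ih =>
    obtain ⟨t₁, h₁, ht₁, hsub, hmem⟩ : ∃ t₁, wilsonRound t (x j.succ) (w j) = some t₁ ∧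
        IsPartialTree G r t₁ ∧ t.verts ⊆ t₁.verts ∧ x j.succ ∈ t₁.verts := by
      by_cases hv : x j.succ ∈ t.verts
      · exact ⟨t, wilsonRound_of_mem hv _, ht, subset_rfl, hv⟩
      · obtain ⟨p, hp⟩ := exists_runUntil_iff.2 (hhit j t.verts ⟨r, ht.root_mem⟩)
        refine ⟨t.addPath (loopErase p), by rw [wilsonRound_of_notMem hv, hp]; rfl,
          ht.addPath (isBranch_of_runUntil (hadj j) hp), Finset.subset_union_left, ?_⟩
        have hhead := head?_loopErase p
        rw [head?_of_runUntil hp, hstart] at hhead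
        exact Finset.mem_union_right _ (List.mem_toFinset.2 (List.mem_of_mem_head? hhead))
    obtain ⟨t', h', ht', hsub', hmem'⟩ := ih ht₁
    refine ⟨t', by rw [List.foldlM_cons, h₁]; exact h', ht', hsub.trans hsub', fun i hi => ?_⟩
    rcases List.mem_cons.1 hi with rfl | hi
    · exact hsub' hmem
    · exact hmem' i hi

/-- For a spanning tree `T` the algorithm outputs `T` if and only if each walk lies in a set
determined by `T`: the loop-erasure which it contributes must be the branch of `T` from its
starting point to the tree built so far. In the product of the probabilities of these sets the
determinants telescope. -/
theorem exists_sets_foldlM_eq_some_iff [Fintype V] [MeasurableSpace V] [MeasurableSingletonClass V]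
    [DecidableRel G.Adj] (hG : G.Connected) (hT : T ∈ spanningTrees G)
    {n : ℕ} {x : Fin (n + 1) → V} {r : V} {js : List (Fin n)} (hjs : js.Nodup)
    {t : PartialTree V} (ht : IsPartialTree G r t) (htT : t.graph ≤ T)
    (hcover : ∀ v, v ∈ t.verts ∨ ∃ j ∈ js, x j.succ = v) :
    ∃ A : Fin n → Set (ℕ → V), (∀ j, MeasurableSet (A j)) ∧
      (∀ w : Fin n → ℕ → V, (∀ j, w j 0 = x j.succ) → (∀ j k, G.Adj (w j k) (w j (k + 1))) →
        ((∃ t', js.foldlM (fun t j => wilsonRound t (x j.succ) (w j)) t = some t' ∧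
          t'.graph = T) ↔ ∀ j ∈ js, w j ∈ A j)) ∧
      (js.map fun j => (srwLaw G (x j.succ)).real (A j)).prod
        * (dirichletLaplacian G t.verts).det = 1 := by
  induction js generalizing t with
  | nil =>
    have huniv : ∀ v, v ∈ t.verts := fun v => (hcover v).resolve_right (by simp)
    refine ⟨fun _ => Set.univ, fun _ => MeasurableSet.univ, fun w _ _ => ?_, ?_⟩
    · exact ⟨fun _ _ h => absurd h List.not_mem_nil,
        fun _ => ⟨t, rfl, ht.graph_eq huniv hT.2 htT⟩⟩
    · rw [Finset.eq_univ_iff_forall.2 huniv, det_dirichletLaplacian_univ]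
      simp
  | cons j js ih =>
    obtain ⟨hj, hjs⟩ := List.nodup_cons.1 hjs
    have hne : ∀ i ∈ js, i ≠ j := fun i hi h => hj (h ▸ hi)
    -- it suffices to treat the first round, which only depends on the walk `w j`
    suffices hround : ∃ (t₁ : PartialTree V) (B : Set (ℕ → V)), IsPartialTree G r t₁ ∧
        t₁.graph ≤ T ∧ t.verts ⊆ t₁.verts ∧ x j.succ ∈ t₁.verts ∧ MeasurableSet B ∧
        (∀ w : ℕ → V, w 0 = x j.succ → (∀ k, G.Adj (w k) (w (k + 1))) → ∀ t₂,
          t₂.graph ≤ T → wilsonRound t (x j.succ) w = some t₂ → w ∈ B) ∧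
        (∀ w ∈ B, wilsonRound t (x j.succ) w = some t₁) ∧
        (srwLaw G (x j.succ)).real B * (dirichletLaplacian G t.verts).det
          = (dirichletLaplacian G t₁.verts).det by
      obtain ⟨t₁, B, ht₁, ht₁T, hsub, hmem, hB, hBmem, hround, hprob⟩ := hround
      obtain ⟨A, hA, hAiff, hAprob⟩ := ih hjs ht₁ ht₁T fun v => by
        rcases hcover v with h | ⟨i, hi, rfl⟩
        · exact Or.inl (hsub h)
        · rcases List.mem_cons.1 hi with rfl | hi
          · exact Or.inl hmem
          · exact Or.inr ⟨i, hi, rfl⟩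
      refine ⟨Function.update A j B, fun i => ?_, fun w hstart hadj => ?_, ?_⟩
      · by_cases h : i = j
        · subst h
          rwa [Function.update_self]
        · rw [Function.update_of_ne h]
          exact hA i
      · rw [List.forall_mem_cons, Function.update_self]
        have hrest : (∀ i ∈ js, w i ∈ Function.update A j B i) ↔ ∀ i ∈ js, w i ∈ A i :=
          forall₂_congr fun i hi => by rw [Function.update_of_ne (hne i hi)]
        rw [hrest, ← hAiff w hstart hadj]
        simp only [List.foldlM_cons, Option.bind_eq_bind, Option.bind_eq_some_iff]
        constructor
        · rintro ⟨t', ⟨t₂, h₂, h'⟩, rfl⟩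
          have hwB := hBmem (w j) (hstart j) (hadj j) t₂ (graph_le_of_foldlM h') h₂
          rw [hround _ hwB, Option.some.injEq] at h₂
          exact ⟨hwB, t', h₂ ▸ h', rfl⟩
        · rintro ⟨hwB, t', h', hgraph⟩
          exact ⟨t', ⟨t₁, hround _ hwB, h'⟩, hgraph⟩
      · have hrest : (js.map fun i => (srwLaw G (x i.succ)).real (Function.update A j B i))
            = js.map fun i => (srwLaw G (x i.succ)).real (A i) :=
          List.map_congr_left fun i hi => by rw [Function.update_of_ne (hne i hi)]
        rw [List.map_cons, List.prod_cons, Function.update_self, hrest, mul_right_comm, hprob,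
          mul_comm, hAprob]
    by_cases hv : x j.succ ∈ t.verts
    · refine ⟨t, Set.univ, ht, htT, subset_rfl, hv, MeasurableSet.univ,
        fun w _ _ _ _ _ => Set.mem_univ w, fun w _ => wilsonRound_of_mem hv w, ?_⟩
      rw [probReal_univ, one_mul]
    · have hnt : Nontrivial V := nontrivial_of_ne _ _ (ne_of_mem_of_not_mem ht.root_mem hv)
      obtain ⟨p, hp⟩ := (hT.2.connected.preconnected (x j.succ) r).exists_isPath
      obtain ⟨l, hl, -⟩ := exists_isBranch_of_isPath ht.root_mem p hp
      have hlG : IsBranch G t.verts (x j.succ :: l) :=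
        hl.of_traversedEdges_le (hl.traversedEdges_le.trans hT.1)
      refine ⟨t.addPath (x j.succ :: l),
        {w | ∃ p, runUntil t.verts w = some p ∧ loopErase p = x j.succ :: l}, ht.addPath hlG,
        sup_le htT hl.traversedEdges_le, Finset.subset_union_left,
        Finset.mem_union_right _ (by simp), measurableSet_exists_runUntil _ _,
        fun w hstart hadj t₂ ht₂ h => ?_, ?_,
        srwLaw_loopErase_mul_det (fun v => hG.preconnected.degree_pos_of_nontrivial v) hlG⟩
      · rw [wilsonRound_of_notMem hv, Option.map_eq_some_iff] at h
        obtain ⟨q, hq, rfl⟩ := h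
        refine ⟨q, hq, ?_⟩
        have hbranch := (isBranch_of_runUntil hadj hq).of_traversedEdges_le
          (le_sup_right.trans ht₂)
        have hhead := head?_loopErase q
        rw [head?_of_runUntil hq, hstart] at hhead
        obtain ⟨l', hl'⟩ := List.head?_eq_some_iff.1 hhead
        rw [hl'] at hbranch ⊢
        rw [hbranch.eq_of_isAcyclic hT.2.isAcyclic (ht.exists_isPath htT) hl]
      · rintro w ⟨q, hq, hlq⟩
        rw [wilsonRound_of_notMem hv, hq, Option.map_some, hlq]

end Trees

/-! ### Uniformity of the output and the number of spanning trees -/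

section Uniformity

variable {V : Type*}

theorem wilson_eq_some_iff [DecidableEq V] {n : ℕ} {x : Fin (n + 1) → V} {w : Fin n → ℕ → V}
    {T : SimpleGraph V} :
    wilson x w = some T ↔ ∃ t', (List.finRange n).foldlM
      (fun t j => wilsonRound t (x j.succ) (w j)) ⟨{x 0}, ⊥⟩ = some t' ∧ t'.graph = T :=
  Option.map_eq_some_iff

theorem mem_or_exists_succ {n : ℕ} (x : Fin (n + 1) ≃ V) (v : V) :
    v ∈ ({x 0} : Finset V) ∨ ∃ j : Fin n, x j.succ = v := by
  obtain ⟨i, rfl⟩ := x.surjective v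
  cases i using Fin.cases with
  | zero => simp
  | succ j => exact Or.inr ⟨j, rfl⟩

variable [Fintype V] [DecidableEq V] [MeasurableSpace V] [MeasurableSingletonClass V]
  {G : SimpleGraph V} [DecidableRel G.Adj] {n : ℕ} (x : Fin (n + 1) ≃ V)
  {Ω : Type*} [MeasurableSpace Ω] {P : Measure Ω} {W : Fin n → Ω → ℕ → V}

/-- Almost surely all walks start where they should, move along edges of `G`, and hit every
nonempty set. -/
theorem ae_walks (hG : G.Connected) (hW : ∀ j, Measurable (W j))
    (hlaw : ∀ j, P.map (W j) = srwLaw G (x j.succ)) :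
    ∀ᵐ ω ∂P, ∀ j, W j ω 0 = x j.succ ∧ (∀ k, G.Adj (W j ω k) (W j ω (k + 1))) ∧
      ∀ S : Finset V, S.Nonempty → ∃ k, W j ω k ∈ S := by
  rw [ae_all_iff]
  intro j
  have hnt : Nontrivial V := nontrivial_of_ne (x j.succ) (x 0) (by simp [Fin.succ_ne_zero])
  have hdeg : ∀ v, 0 < G.degree v := fun v => hG.preconnected.degree_pos_of_nontrivial v
  have h : ∀ᵐ w ∂P.map (W j), w 0 = x j.succ ∧ (∀ k, G.Adj (w k) (w (k + 1))) ∧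
      ∀ S : Finset V, S.Nonempty → ∃ k, w k ∈ S := by
    rw [hlaw]
    filter_upwards [ae_srwLaw_start G (x j.succ), ae_srwLaw_adj G hdeg (x j.succ),
      ae_all_iff.2 fun S : Finset V => Filter.eventually_imp_distrib_left.2 fun hS : S.Nonempty =>
        ae_exists_mem hG hdeg hS (x j.succ)] with w h1 h2 h3
    exact ⟨h1, h2, h3⟩
  exact ae_of_ae_map (hW j).aemeasurable h

theorem ae_wilson_mem_spanningTrees (hG : G.Connected) (hW : ∀ j, Measurable (W j))
    (hlaw : ∀ j, P.map (W j) = srwLaw G (x j.succ)) :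
    ∀ᵐ ω ∂P, ∃ T ∈ spanningTrees G, wilson x (fun j => W j ω) = some T := by
  filter_upwards [ae_walks x hG hW hlaw] with ω h
  obtain ⟨t', h', ht', hsub, hmem⟩ := exists_foldlM_eq_some (x := x) (fun j => (h j).1)
    (fun j => (h j).2.1) (fun j => (h j).2.2) (List.finRange n)
    (IsPartialTree.singleton G (x 0))
  refine ⟨t'.graph, ht'.graph_mem_spanningTrees fun v => ?_,
    wilson_eq_some_iff.2 ⟨t', h', rfl⟩⟩
  rcases mem_or_exists_succ x v with hv | ⟨j, rfl⟩
  · exact hsub hv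
  · exact hmem j (List.mem_finRange j)

/-- By independence the probability of a spanning tree is the product of the probabilities of the
conditions on the single walks. -/
theorem nullMeasurableSet_and_measure_wilson_mul_det [IsProbabilityMeasure P]
    (hG : G.Connected) (hW : ∀ j, Measurable (W j))
    (hlaw : ∀ j, P.map (W j) = srwLaw G (x j.succ)) (hindep : iIndepFun W P)
    {T : SimpleGraph V} (hT : T ∈ spanningTrees G) :
    NullMeasurableSet {ω | wilson x (fun j => W j ω) = some T} P ∧
      P.real {ω | wilson x (fun j => W j ω) = some T} * (dirichletLaplacian G {x 0}).det = 1 := by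
  obtain ⟨A, hA, hiff, hprod⟩ := exists_sets_foldlM_eq_some_iff (x := x) hG hT
    (List.nodup_finRange n) (IsPartialTree.singleton G (x 0)) bot_le fun v =>
      (mem_or_exists_succ x v).imp_right fun ⟨j, hj⟩ => ⟨j, List.mem_finRange j, hj⟩
  have hae : {ω | wilson x (fun j => W j ω) = some T} =ᵐ[P] ⋂ j, W j ⁻¹' A j := by
    filter_upwards [ae_walks x hG hW hlaw] with ω h
    have hmem : (∀ j ∈ List.finRange n, W j ω ∈ A j) ↔ ω ∈ ⋂ j, W j ⁻¹' A j := by simp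
    exact propext (wilson_eq_some_iff.trans ((hiff _ (fun j => (h j).1)
      fun j => (h j).2.1).trans hmem))
  have hmeas : MeasurableSet (⋂ j, W j ⁻¹' A j) := MeasurableSet.iInter fun j => hW j (hA j)
  refine ⟨hmeas.nullMeasurableSet.congr hae.symm, ?_⟩
  rw [measureReal_congr hae, ← hprod, ← List.ofFn_eq_map, List.prod_ofFn]
  congr 1
  have h := hindep.measure_inter_preimage_eq_mul Finset.univ (sets := A) fun j _ => hA j
  simp only [Finset.mem_univ, Set.iInter_true] at h
  rw [Measure.real, h, ENNReal.toReal_prod]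
  refine Finset.prod_congr rfl fun j _ => ?_
  rw [← hlaw j, measureReal_def, Measure.map_apply (hW j) (hA j)]

/-- Summing over the spanning trees: each of them is output with probability `1 / N`, and `N` is
the determinant. -/
theorem measure_wilson_eq_inv_and_ncard [IsProbabilityMeasure P] (hG : G.Connected)
    (hW : ∀ j, Measurable (W j)) (hlaw : ∀ j, P.map (W j) = srwLaw G (x j.succ))
    (hindep : iIndepFun W P) :
    (∀ T ∈ spanningTrees G, P {ω | wilson x (fun j => W j ω) = some T}
      = ((spanningTrees G).ncard : ENNReal)⁻¹) ∧
    ((spanningTrees G).ncard : ℝ) = (dirichletLaplacian G {x 0}).det := by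
  classical
  have hfin : (spanningTrees G).Finite := Set.toFinite _
  have hdet := det_dirichletLaplacian_ne_zero hG (Finset.singleton_nonempty (x 0))
  have hreal : ∀ T ∈ spanningTrees G, P.real {ω | wilson x (fun j => W j ω) = some T}
      = (dirichletLaplacian G {x 0}).det⁻¹ := fun T hT =>
    eq_inv_of_mul_eq_one_left
      (nullMeasurableSet_and_measure_wilson_mul_det x hG hW hlaw hindep hT).2
  have hsum : ∑ T ∈ hfin.toFinset, P {ω | wilson x (fun j => W j ω) = some T} = 1 := by
    rw [← measure_biUnion_finset₀]
    · rw [← measure_univ (μ := P)]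
      refine measure_congr (Filter.eventuallyEq_univ.2 ?_)
      filter_upwards [ae_wilson_mem_spanningTrees x hG hW hlaw] with ω ⟨T, hT, h⟩
      exact Set.mem_biUnion (hfin.mem_toFinset.2 hT) h
    · intro T _ T' _ hTT'
      refine Disjoint.aedisjoint (Set.disjoint_left.2 fun ω h h' => hTT' ?_)
      exact Option.some.inj (h.symm.trans h')
    · exact fun T hT =>
        (nullMeasurableSet_and_measure_wilson_mul_det x hG hW hlaw hindep
          (hfin.mem_toFinset.1 hT)).1
  have hconst : ∀ T ∈ spanningTrees G, P {ω | wilson x (fun j => W j ω) = some T}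
      = ENNReal.ofReal (dirichletLaplacian G {x 0}).det⁻¹ := fun T hT => by
    rw [← hreal T hT, ofReal_measureReal]
  rw [Finset.sum_congr rfl fun T hT => hconst T (hfin.mem_toFinset.1 hT), Finset.sum_const,
    nsmul_eq_mul, ← Set.ncard_eq_toFinset_card _ hfin] at hsum
  refine ⟨fun T hT => ?_, ?_⟩
  · rw [hconst T hT]
    exact ENNReal.eq_inv_of_mul_eq_one_left (by rwa [mul_comm])
  · obtain ⟨T, hT⟩ := hG.exists_isTree_le
    have hnonneg : 0 ≤ (dirichletLaplacian G {x 0}).det⁻¹ := hreal T hT ▸ measureReal_nonneg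
    have h := congrArg ENNReal.toReal hsum
    rw [ENNReal.toReal_mul, ENNReal.toReal_natCast, ENNReal.toReal_ofReal hnonneg,
      ENNReal.toReal_one] at h
    exact (mul_inv_eq_one₀ hdet).1 h

/-- The number of spanning trees is obtained from the algorithm, run with independent walks on a
product space. -/
theorem ncard_spanningTrees (hG : G.Connected) :
    ((spanningTrees G).ncard : ℤ) = (reducedLaplacian G x).det := by
  have h := (measure_wilson_eq_inv_and_ncard x hG (Ω := Fin n → ℕ → V)
    (P := Measure.pi fun j => srwLaw G (x j.succ)) (W := fun j ω => ω j)
    (fun j => measurable_pi_apply j)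
    (fun j => (measurePreserving_eval (fun j : Fin n => srwLaw G (x j.succ)) j).map_eq)
    (iIndepFun_pi (X := fun _ => id) fun _ => aemeasurable_id)).2
  rw [← det_reducedLaplacian] at h
  exact_mod_cast h

end Uniformity

end Wilson

theorem mainTheorem3 {V : Type*} [Fintype V] [DecidableEq V]
    [MeasurableSpace V] [MeasurableSingletonClass V]
    (G : SimpleGraph V) [DecidableRel G.Adj] (hG : G.Connected)
    {n : ℕ} (x : Fin (n + 1) ≃ V) :
    (∀ {Ω : Type*} [MeasurableSpace Ω] (P : Measure Ω) [IsProbabilityMeasure P]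
      (W : Fin n → Ω → ℕ → V),
      (∀ j, Measurable (W j)) →
      (∀ j, P.map (W j) = Wilson.srwLaw G (x j.succ)) →
      iIndepFun W P →
      (∀ᵐ ω ∂P, ∃ T ∈ Wilson.spanningTrees G,
        Wilson.wilson x (fun j => W j ω) = some T) ∧
      ∀ T ∈ Wilson.spanningTrees G,
        P {ω | Wilson.wilson x (fun j => W j ω) = some T} =
          ((Wilson.spanningTrees G).ncard : ENNReal)⁻¹) ∧
    ((Wilson.spanningTrees G).ncard : ℤ) = (Wilson.reducedLaplacian G x).det ∧
    ∀ y : Fin (n + 1) ≃ V,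
      (Wilson.reducedLaplacian G x).det = (Wilson.reducedLaplacian G y).det := by
  refine ⟨fun P _ W hW hlaw hindep => ⟨Wilson.ae_wilson_mem_spanningTrees x hG hW hlaw,
    (Wilson.measure_wilson_eq_inv_and_ncard x hG hW hlaw hindep).1⟩,
    Wilson.ncard_spanningTrees x hG, fun y => ?_⟩
  rw [← Wilson.ncard_spanningTrees x hG, ← Wilson.ncard_spanningTrees y hG]
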